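/- Let $\mathcal H_1,\mathcal H_2,\mathcal H_3,\mathcal H_4$ be separable Hilbert spaces over $\mathbb R$ or $\mathbb C$ (the same field for all), let $r\in\mathbb N$, let $M:\mathcal H_1\to\mathcal H_4$ be Hilbert--Schmidt and let $B:\mathcal H_3\to\mathcal H_4$, $C:\mathcal H_1\to\mathcal H_2$ be bounded linear operators. For a bounded operator $T$, the Moore--Penrose inverse $T^\dagger$ is the (possibly unbounded) operator with domain $\operatorname{ran}T\oplus(\operatorname{ran}T)^\perp$ given by $T^\dagger(h+k)=(T|_{(\ker T)^\perp})^{-1}h$ for $h\in\operatorname{ran}T$, $k\in(\operatorname{ran}T)^\perp$; $P_U$ is the orthogonal projector onto a closed subspace $U$; compositions of partially defined operators have their natural domains, $\operatorname{dom}(TS)=S^{-1}(\operatorname{dom}T)$. Let $\mathcal B_{00,r}(\mathcal H,\mathcal K)$ be the set of everywhere defined bounded operators $\mathcal H\to\mathcal K$ of rank at most $r$. Let $\mathcal X_r$ be the set of (possibly unbounded, partially defined) linear operators $X$ from $\mathcal H_2$ to $\mathcal H_3$ with $\operatorname{dom}X\supset\operatorname{dom}C^\dagger$, $\dim\operatorname{ran}X\le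 r$ and $BXC$ Hilbert--Schmidt. Let $\mathcal Y_r$ be the set of $Y\in\mathcal B_{00,r}(\mathcal H_1,\mathcal H_4)$ with $\operatorname{ran}Y\subset\operatorname{dom}B^\dagger$ that minimise $\|P_{\overline{\operatorname{ran}B}}MP_{(\ker C)^\perp}-\tilde Y\|_{HS}$ over $\tilde Y\in\mathcal B_{00,r}(\mathcal H_1,\mathcal H_4)$. Suppose $\mathcal Y_r\neq\emptyset$. Let $Y\in\mathcal Y_r$ be arbitrary (that is, $Y$ is a rank-$r$ truncated singular value decomposition $(P_{\overline{\operatorname{ran}B}}MP_{(\ker C)^\perp})_r$ mapping into $\operatorname{dom}B^\dagger$), and put $\hat X:=B^\dagger YC^\dagger$. Then $\operatorname{dom}\hat X=\operatorname{dom}C^\dagger$, $\hat X\in\mathcal X_r$ (in particular $B\hat XC$ is an everywhere defined Hilbert--Schmidt operator), and the following hold. (1) Let $(V_n)_n$ be an increasing sequence of finite-dimensional subspaces of $\overline{\operatorname{ran}C}$ with $\overline{\bigcup_nV_n}=\overline{\operatorname{ran}C}$. Let $U_n:=C^*V_n$, let $C_n:=P_{V_n}C$, and let $C_n^\#:\mathcal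 H_2\to\mathcal H_1$ be the linear operator which is $(C_n|_{U_n}:U_n\to V_n)^{-1}$ on $V_n$ and $0$ on $V_n^\perp$. Put $\hat X_n:=B^\dagger YC_n^\#$. Then $\hat X_n\in\mathcal B_{00,r}(\mathcal H_2,\mathcal H_3)$ for all $n$; $\hat X_nh\to\hat Xh$ for every $h\in\operatorname{dom}\hat X$; $B\hat X_nC$ is Hilbert--Schmidt for all $n$ and $\|B\hat X_nC-B\hat XC\|_{HS}\to0$; and $P_{(\ker B)^\perp}\hat X_nP_{\overline{\operatorname{ran}C}}=\hat X_n$ for all $n$. (2) The minimum of $\|M-BXC\|_{HS}$ over $X\in\mathcal X_r$ is attained at $\hat X$, and $$\inf\{\|M-BXC\|_{HS}:X\in\mathcal B_{00,r}(\mathcal H_2,\mathcal H_3)\}=\min\{\|M-BXC\|_{HS}:X\in\mathcal X_r\}=\|M-B\hat XC\|_{HS}.$$ -/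

import Mathlib

open Filter Topology

noncomputable section

namespace RankApprox

variable {𝕜 E F G : Type*} [RCLike 𝕜]
  [NormedAddCommGroup E] [InnerProductSpace 𝕜 E]
  [NormedAddCommGroup F] [InnerProductSpace 𝕜 F]
  [NormedAddCommGroup G] [InnerProductSpace 𝕜 G]

/-! ### Partially defined linear operators -/

/-- A bounded operator, seen as a linear operator whose domain is the whole space. -/
def everywhere (T : E →L[𝕜] F) : E →ₗ.[𝕜] F := (T : E →ₗ[𝕜] F).toPMap ⊤

/-- The composition `TS` of partially defined operators, with its natural domain
`S⁻¹(dom T) = {x ∈ dom S : S x ∈ dom T}`. -/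
def pcomp (T : F →ₗ.[𝕜] G) (S : E →ₗ.[𝕜] F) : E →ₗ.[𝕜] G :=
  T.comp (S.domRestrict ((T.domain.comap S.toFun).map S.domain.subtype)) (by
    rintro ⟨x, hx⟩
    obtain ⟨y, hy, hyx⟩ := (Submodule.mem_map.1 hx.1)
    subst hyx
    exact hy)

lemma mem_domain_pcomp {T : F →ₗ.[𝕜] G} {S : E →ₗ.[𝕜] F} {x : E} :
    x ∈ (pcomp T S).domain ↔ ∃ h : x ∈ S.domain, S ⟨x, h⟩ ∈ T.domain := by
  change x ∈ ((T.domain.comap S.toFun).map S.domain.subtype) ⊓ S.domain ↔ _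
  constructor
  · rintro ⟨hx, h⟩
    obtain ⟨y, hy, rfl⟩ := Submodule.mem_map.1 hx
    exact ⟨h, hy⟩
  · rintro ⟨h, hT⟩
    exact ⟨Submodule.mem_map.2 ⟨⟨x, h⟩, hT, rfl⟩, h⟩

lemma pcomp_apply {T : F →ₗ.[𝕜] G} {S : E →ₗ.[𝕜] F} {x : E} (h : x ∈ S.domain)
    (hT : S ⟨x, h⟩ ∈ T.domain) (hx : x ∈ (pcomp T S).domain) :
    pcomp T S ⟨x, hx⟩ = T ⟨S ⟨x, h⟩, hT⟩ := rfl

/-- Invert `T` on its restriction to `U` (which `T` maps into `V`), and extend the inverse by `0`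
on the orthogonal complement of `V`. The domain of the result is `T(U) ⊕ Vᗮ`. -/
def invExtZero (T : E →L[𝕜] F) (U : Submodule 𝕜 E) (V : Submodule 𝕜 F)
    (hUV : ∀ x ∈ U, T x ∈ V) : F →ₗ.[𝕜] E :=
  ((T : E →ₗ[𝕜] F).toPMap U).inverse.sup ((0 : F →ₗ[𝕜] E).toPMap Vᗮ)
    (LinearPMap.sup_h_of_disjoint _ _ (by
      rw [LinearPMap.inverse_domain]
      refine (Submodule.orthogonal_disjoint V).mono_left ?_
      rintro _ ⟨x, rfl⟩
      exact hUV _ x.2))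

/-- The Moore--Penrose inverse `T†`: with domain `ran T ⊕ (ran T)ᗮ`, it is the inverse of
`T` restricted to `(ker T)ᗮ` on `ran T`, and zero on `(ran T)ᗮ`. -/
def mpInv (T : E →L[𝕜] F) : F →ₗ.[𝕜] E :=
  invExtZero T (T.ker)ᗮ T.range (fun x _ => ⟨x, rfl⟩)

/-- On `ran T ⊕ (ran T)ᗮ` one has `T†(T x + k) = x` for `x ∈ (ker T)ᗮ`, `k ∈ (ran T)ᗮ`. -/
lemma mpInv_apply (T : E →L[𝕜] F) {x : E} (hx : x ∈ (T.ker)ᗮ) {k : F} (hk : k ∈ (T.range)ᗮ)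
    (h : T x + k ∈ (mpInv T).domain) : mpInv T ⟨T x + k, h⟩ = x := by
  have hker : ((T : E →ₗ[𝕜] F).toPMap (T.ker)ᗮ).toFun.ker = ⊥ := by
    rw [LinearMap.ker_eq_bot']
    rintro ⟨y, hy⟩ hTy
    have h0 : y ∈ T.ker := hTy
    have : y = 0 := Submodule.disjoint_def.1 (Submodule.orthogonal_disjoint T.ker) y h0 hy
    exact Subtype.ext this
  have hTx : T x ∈ (((T : E →ₗ[𝕜] F).toPMap (T.ker)ᗮ).inverse).domain := by
    rw [LinearPMap.inverse_domain]
    exact ⟨⟨x, hx⟩, rfl⟩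
  have e := LinearPMap.sup_apply
    (f := ((T : E →ₗ[𝕜] F).toPMap (T.ker)ᗮ).inverse)
    (g := (0 : F →ₗ[𝕜] E).toPMap (T.range)ᗮ)
    (LinearPMap.sup_h_of_disjoint _ _ (by
      rw [LinearPMap.inverse_domain]
      refine (Submodule.orthogonal_disjoint T.range).mono_left ?_
      rintro _ ⟨x, rfl⟩
      exact ⟨x, rfl⟩)) ⟨T x, hTx⟩ ⟨k, hk⟩ ⟨T x + k, h⟩ rfl
  refine e.trans ?_
  rw [LinearPMap.inverse_apply_eq hker (x := ⟨x, hx⟩) rfl]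
  simp

lemma mpInv_domain [CompleteSpace E] (T : E →L[𝕜] F) : (mpInv T).domain = T.range ⊔ (T.range)ᗮ := by
  change (((T : E →ₗ[𝕜] F).toPMap (T.ker)ᗮ).inverse).domain ⊔ (T.range)ᗮ = _
  rw [LinearPMap.inverse_domain]
  congr 1
  apply le_antisymm
  · rintro _ ⟨x, rfl⟩
    exact ⟨x, rfl⟩
  · rintro _ ⟨x, rfl⟩
    obtain ⟨a, ha, b, hb, rfl⟩ := Submodule.exists_add_mem_mem_orthogonal (K := T.ker) x
    refine ⟨⟨b, hb⟩, ?_⟩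
    have : T a = 0 := ha
    change T b = T (a + b)
    simp [this]

/-- The outer inverse `C_V^#` of `C` attached to a finite-dimensional subspace `V` of the target:
with `U = C* V` and `P` the orthogonal projector onto `V`, it is the inverse of `P C : U → V` on
`V`, and zero on `Vᗮ`. -/
def outerInv [CompleteSpace E] [CompleteSpace F] (C : E →L[𝕜] F) (V : Submodule 𝕜 F) [FiniteDimensional 𝕜 V] : F →ₗ.[𝕜] E :=
  invExtZero (V.starProjection ∘L C)
    (V.map (ContinuousLinearMap.adjoint C : F →ₗ[𝕜] E)) V
    (fun x _ => by simp)

/-! ### Hilbert--Schmidt operators -/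

/-- `T` is Hilbert--Schmidt: `∑ ‖T eᵢ‖² < ∞` for some orthonormal (Hilbert) basis `(eᵢ)`. -/
def IsHilbertSchmidt (T : E →L[𝕜] F) : Prop :=
  ∃ (w : Set E) (b : HilbertBasis w 𝕜 E), Summable fun i => ‖T (b i)‖ ^ 2

/-- A chosen Hilbert basis. -/
def someBasis (𝕜 E : Type*) [RCLike 𝕜] [NormedAddCommGroup E] [InnerProductSpace 𝕜 E]
    [CompleteSpace E] : HilbertBasis (exists_hilbertBasis 𝕜 E).choose 𝕜 E :=
  (exists_hilbertBasis 𝕜 E).choose_spec.choose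

/-- The Hilbert--Schmidt norm `(∑ ‖T eᵢ‖²)^(1/2)` (meaningful for Hilbert--Schmidt `T`). -/
def hsNorm [CompleteSpace E] (T : E →L[𝕜] F) : ℝ :=
  √(∑' i, ‖T (someBasis 𝕜 E i)‖ ^ 2)

section Independence

variable [CompleteSpace E] [CompleteSpace F]

lemma tsum_sq_inner {ι : Type*} (b : HilbertBasis ι 𝕜 E) (x : E) :
    ∑' i, ENNReal.ofReal (‖inner 𝕜 (b i) x‖ ^ 2) = ENNReal.ofReal (‖x‖ ^ 2) := by
  have h : HasSum (fun i => ‖inner 𝕜 (b i) x‖ ^ 2) (‖x‖ ^ 2) := by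
    have := (RCLike.hasSum_iff (𝕜 := 𝕜) _ _).1 (b.hasSum_inner_mul_inner x x)
    convert this.1 using 1
    · funext i
      rw [← inner_conj_symm x, RCLike.conj_mul, ← RCLike.ofReal_pow, RCLike.ofReal_re]
    · rw [inner_self_eq_norm_sq_to_K, ← RCLike.ofReal_pow, RCLike.ofReal_re]
  rw [← h.tsum_eq, ENNReal.ofReal_tsum_of_nonneg (fun _ => by positivity) h.summable]

lemma tsum_sq_adjoint {ι κ : Type*} (b : HilbertBasis ι 𝕜 E) (c : HilbertBasis κ 𝕜 F)
    (T : E →L[𝕜] F) :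
    ∑' i, ENNReal.ofReal (‖T (b i)‖ ^ 2) =
      ∑' j, ENNReal.ofReal (‖ContinuousLinearMap.adjoint T (c j)‖ ^ 2) := by
  simp_rw [← tsum_sq_inner c, ← tsum_sq_inner b]
  rw [ENNReal.tsum_comm]
  refine tsum_congr fun j => tsum_congr fun i => ?_
  rw [ContinuousLinearMap.adjoint_inner_right, norm_inner_symm]

lemma tsum_sq_eq {ι κ : Type*} (b : HilbertBasis ι 𝕜 E) (c : HilbertBasis κ 𝕜 E)
    (T : E →L[𝕜] F) :
    ∑' i, ENNReal.ofReal (‖T (b i)‖ ^ 2) = ∑' i, ENNReal.ofReal (‖T (c i)‖ ^ 2) := by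
  rw [tsum_sq_adjoint b (someBasis 𝕜 F), tsum_sq_adjoint c (someBasis 𝕜 F)]

lemma summable_iff_ofReal {ι : Type*} {f : ι → ℝ} (hf : ∀ i, 0 ≤ f i) :
    Summable f ↔ ∑' i, ENNReal.ofReal (f i) ≠ ⊤ := by
  constructor
  · intro h
    rw [← ENNReal.ofReal_tsum_of_nonneg hf h]
    exact ENNReal.ofReal_ne_top
  · intro h
    have := ENNReal.summable_toReal h
    simpa [ENNReal.toReal_ofReal (hf _)] using this

/-- Being Hilbert--Schmidt does not depend on the basis. -/
lemma isHilbertSchmidt_iff {ι : Type*} (b : HilbertBasis ι 𝕜 E) (T : E →L[𝕜] F) :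
    IsHilbertSchmidt T ↔ Summable fun i => ‖T (b i)‖ ^ 2 := by
  have key : ∀ {κ κ' : Type _} (c : HilbertBasis κ 𝕜 E) (d : HilbertBasis κ' 𝕜 E),
      (Summable fun i => ‖T (c i)‖ ^ 2) → Summable fun i => ‖T (d i)‖ ^ 2 := by
    intro κ κ' c d h
    rw [summable_iff_ofReal (fun _ => by positivity)] at h ⊢
    rwa [tsum_sq_eq d c]
  constructor
  · rintro ⟨w, c, h⟩
    exact key c b h
  · intro h
    refine ⟨_, someBasis 𝕜 E, ?_⟩
    rw [summable_iff_ofReal (fun _ => by positivity)] at h ⊢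
    rwa [tsum_sq_eq _ b]

/-- The Hilbert--Schmidt norm does not depend on the basis. -/
lemma hsNorm_eq {ι : Type*} (b : HilbertBasis ι 𝕜 E) (T : E →L[𝕜] F) :
    hsNorm T = √(∑' i, ‖T (b i)‖ ^ 2) := by
  have key : ∀ {κ : Type _} (c : HilbertBasis κ 𝕜 E),
      ∑' i, ‖T (c i)‖ ^ 2 = (∑' i, ENNReal.ofReal (‖T (c i)‖ ^ 2)).toReal := by
    intro κ c
    rw [ENNReal.tsum_toReal_eq (fun _ => ENNReal.ofReal_ne_top)]
    exact tsum_congr fun i => (ENNReal.toReal_ofReal (by positivity)).symm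
  have key' : ∑' i, ‖T (b i)‖ ^ 2 = (∑' i, ENNReal.ofReal (‖T (b i)‖ ^ 2)).toReal := by
    rw [ENNReal.tsum_toReal_eq (fun _ => ENNReal.ofReal_ne_top)]
    exact tsum_congr fun i => (ENNReal.toReal_ofReal (by positivity)).symm
  rw [hsNorm, key, key', tsum_sq_eq _ b]

end Independence

/-! ### The approximation problem -/

/-- The bounded, everywhere defined operators of rank at most `r`. -/
def boundedRankLE (𝕜 E F : Type*) [RCLike 𝕜] [NormedAddCommGroup E] [InnerProductSpace 𝕜 E]
    [NormedAddCommGroup F] [InnerProductSpace 𝕜 F] (r : ℕ) : Set (E →L[𝕜] F) :=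
  {T | LinearMap.rank (T : E →ₗ[𝕜] F) ≤ r}

section Problem

variable {H₁ H₂ H₃ H₄ : Type*}
  [NormedAddCommGroup H₁] [InnerProductSpace 𝕜 H₁] [CompleteSpace H₁]
  [NormedAddCommGroup H₂] [InnerProductSpace 𝕜 H₂] [CompleteSpace H₂]
  [NormedAddCommGroup H₃] [InnerProductSpace 𝕜 H₃] [CompleteSpace H₃]
  [NormedAddCommGroup H₄] [InnerProductSpace 𝕜 H₄] [CompleteSpace H₄]

/-- The orthogonal projector onto `closure (ran T)`. -/
def projRan (T : H₁ →L[𝕜] H₂) : H₂ →L[𝕜] H₂ := (T.range).topologicalClosure.starProjection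

/-- The orthogonal projector onto `(ker T)ᗮ`. -/
def projKerPerp (T : H₁ →L[𝕜] H₂) : H₁ →L[𝕜] H₁ := ((T.ker)ᗮ).starProjection

/-- `P_{closure (ran B)} M P_{(ker C)ᗮ}`. -/
def projected (M : H₁ →L[𝕜] H₄) (B : H₃ →L[𝕜] H₄) (C : H₁ →L[𝕜] H₂) : H₁ →L[𝕜] H₄ :=
  projRan B ∘L M ∘L projKerPerp C

/-- The class `𝒳_r` of possibly unbounded linear operators `X` from `H₂` to `H₃` with
`dom X ⊇ dom C†`, `dim ran X ≤ r` and `B X C` an (everywhere defined) Hilbert--Schmidt operator. -/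
def classX (B : H₃ →L[𝕜] H₄) (C : H₁ →L[𝕜] H₂) (r : ℕ) : Set (H₂ →ₗ.[𝕜] H₃) :=
  {X | (mpInv C).domain ≤ X.domain ∧ LinearMap.rank X.toFun ≤ r ∧
    ∃ S : H₁ →L[𝕜] H₄,
      pcomp (everywhere B) (pcomp X (everywhere C)) = everywhere S ∧ IsHilbertSchmidt S}

/-- The class `𝒴_r` of best rank-`r` approximations `(P_{closure (ran B)} M P_{(ker C)ᗮ})_r` in
Hilbert--Schmidt norm whose range is contained in `dom B†`. -/
def classY (M : H₁ →L[𝕜] H₄) (B : H₃ →L[𝕜] H₄) (C : H₁ →L[𝕜] H₂) (r : ℕ) :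
    Set (H₁ →L[𝕜] H₄) :=
  {Y | Y ∈ boundedRankLE 𝕜 H₁ H₄ r ∧ Y.range ≤ (mpInv B).domain ∧
    ∀ Y' ∈ boundedRankLE 𝕜 H₁ H₄ r,
      hsNorm (projected M B C - Y) ≤ hsNorm (projected M B C - Y')}

/-- `X̂ = B† Y C†`. -/
def hatX (B : H₃ →L[𝕜] H₄) (C : H₁ →L[𝕜] H₂) (Y : H₁ →L[𝕜] H₄) : H₂ →ₗ.[𝕜] H₃ :=
  pcomp (mpInv B) (pcomp (everywhere Y) (mpInv C))

/-- `X̂_V = B† Y C_V^#`, for a finite-dimensional subspace `V` of `H₂`. -/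
def hatXApprox (B : H₃ →L[𝕜] H₄) (C : H₁ →L[𝕜] H₂) (Y : H₁ →L[𝕜] H₄)
    (V : Submodule 𝕜 H₂) [FiniteDimensional 𝕜 V] : H₂ →ₗ.[𝕜] H₃ :=
  pcomp (mpInv B) (pcomp (everywhere Y) (outerInv C V))

/-- The values `‖M - B X C‖_HS` of the unbounded problem, `X ∈ 𝒳_r`. -/
def errorsX (M : H₁ →L[𝕜] H₄) (B : H₃ →L[𝕜] H₄) (C : H₁ →L[𝕜] H₂) (r : ℕ) : Set ℝ :=
  {e | ∃ X ∈ classX B C r, ∃ S : H₁ →L[𝕜] H₄,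
    pcomp (everywhere B) (pcomp X (everywhere C)) = everywhere S ∧ e = hsNorm (M - S)}

/-- The values `‖M - B X C‖_HS` of the bounded problem, `X` bounded of rank at most `r`. -/
def errorsBounded (M : H₁ →L[𝕜] H₄) (B : H₃ →L[𝕜] H₄) (C : H₁ →L[𝕜] H₂) (r : ℕ) : Set ℝ :=
  {e | ∃ X ∈ boundedRankLE 𝕜 H₂ H₃ r, e = hsNorm (M - B ∘L X ∘L C)}

end Problem

end RankApprox

end

noncomputable section

namespace RankApprox

open ContinuousLinearMap (adjoint)

/-! ### Elementary facts on norms and sums. -/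

section Preliminaries

variable {𝕜 E F : Type*} [RCLike 𝕜]
  [NormedAddCommGroup E] [InnerProductSpace 𝕜 E]
  [NormedAddCommGroup F] [InnerProductSpace 𝕜 F]

/-! Write `P` for the projector onto the closure of `ran B`, `Q` for the one onto `(ker C)ᗮ`, and `N
= P M Q`. Any `S = B X C` satisfies `P S = S = S Q`, so by Pythagoras `‖M - S‖² = ‖N - S‖² + c` with
`c` independent of `S` (`exists_hsNorm_sq_sub_eq`). As `S` has rank at most `r`, no error is below
that of a best rank-`r` approximation `Y` of `N` (`hsNorm_sub_le_of_mem_classY`).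

This bound is attained. Compressing `Y` by `P` or `Q` cannot reduce its error, which forces `P Y = Y
= Y Q`; with `ran Y ⊆ dom B†` this gives `ran Y ⊆ ran B`. Hence `Z = B† Y` is bounded of rank at
most `r` with `B Z = Y` (`exists_mpInv_comp`), so `X̂ = Z C†` and `B X̂ C = Y Q = Y`.

For the bounded problem, `C_V^# C` is the orthogonal projector onto `C* V`
(`exists_outerInv_eq_everywhere`), and the spaces `C* Vₙ` exhaust `(ker C)ᗮ`. Thus `B X̂ₙ C` is `Y`
composed with projectors tending strongly to `Q`, and the finite rank of `Y` upgrades this to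
Hilbert--Schmidt convergence to `Y`. -/

lemma hsNorm_nonneg [CompleteSpace E] (T : E →L[𝕜] F) : 0 ≤ hsNorm T := Real.sqrt_nonneg _

lemma hsNorm_sq [CompleteSpace E] (T : E →L[𝕜] F) :
    hsNorm T ^ 2 = ∑' i, ‖T (someBasis 𝕜 E i)‖ ^ 2 :=
  Real.sq_sqrt (tsum_nonneg fun _ => by positivity)

lemma sq_norm_sub_le {V : Type*} [SeminormedAddCommGroup V] (x y : V) :
    ‖x - y‖ ^ 2 ≤ 2 * (‖x‖ ^ 2 + ‖y‖ ^ 2) := by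
  have h1 := norm_sub_le x y
  have h2 : ‖x - y‖ ^ 2 ≤ (‖x‖ + ‖y‖) ^ 2 := by gcongr
  nlinarith [sq_nonneg (‖x‖ - ‖y‖)]

/-- Holds also for divergent sums, where both sides are `0`; this is why `hsNorm_adjoint` needs no
summability. -/
lemma tsum_eq_toReal_tsum_ofReal {ι : Type*} {f : ι → ℝ} (hf : ∀ i, 0 ≤ f i) :
    ∑' i, f i = (∑' i, ENNReal.ofReal (f i)).toReal := by
  rw [ENNReal.tsum_toReal_eq (fun _ => ENNReal.ofReal_ne_top)]
  exact tsum_congr fun i => (ENNReal.toReal_ofReal (hf i)).symm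

end Preliminaries

/-! ### Hilbert--Schmidt operators: ideal property, Pythagoras, convergence. -/

section HilbertSchmidt

variable {𝕜 E F G : Type*} [RCLike 𝕜]
  [NormedAddCommGroup E] [InnerProductSpace 𝕜 E] [CompleteSpace E]
  [NormedAddCommGroup F] [InnerProductSpace 𝕜 F] [CompleteSpace F]
  [NormedAddCommGroup G] [InnerProductSpace 𝕜 G] [CompleteSpace G]

lemma isHilbertSchmidt_adjoint_iff (T : E →L[𝕜] F) :
    IsHilbertSchmidt (adjoint T) ↔ IsHilbertSchmidt T := by
  rw [isHilbertSchmidt_iff (someBasis 𝕜 E), isHilbertSchmidt_iff (someBasis 𝕜 F),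
    summable_iff_ofReal (fun _ => by positivity), summable_iff_ofReal (fun _ => by positivity),
    tsum_sq_adjoint (someBasis 𝕜 E) (someBasis 𝕜 F)]

lemma hsNorm_adjoint (T : E →L[𝕜] F) : hsNorm (adjoint T) = hsNorm T := by
  rw [hsNorm, hsNorm, tsum_eq_toReal_tsum_ofReal (fun _ => by positivity),
    tsum_eq_toReal_tsum_ofReal (fun _ => by positivity),
    tsum_sq_adjoint (someBasis 𝕜 E) (someBasis 𝕜 F)]

lemma IsHilbertSchmidt.summable {T : E →L[𝕜] F} (hT : IsHilbertSchmidt T) {ι : Type*}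
    (b : HilbertBasis ι 𝕜 E) : Summable fun i => ‖T (b i)‖ ^ 2 :=
  (isHilbertSchmidt_iff b T).1 hT

lemma IsHilbertSchmidt.sub {S T : E →L[𝕜] F} (hS : IsHilbertSchmidt S)
    (hT : IsHilbertSchmidt T) : IsHilbertSchmidt (S - T) := by
  rw [isHilbertSchmidt_iff (someBasis 𝕜 E)]
  exact .of_nonneg_of_le (fun _ => by positivity) (fun i => sq_norm_sub_le _ _)
    (((hS.summable _).add (hT.summable _)).mul_left 2)

lemma IsHilbertSchmidt.comp_left {T : E →L[𝕜] F} (hT : IsHilbertSchmidt T) (L : F →L[𝕜] G) :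
    IsHilbertSchmidt (L ∘L T) := by
  rw [isHilbertSchmidt_iff (someBasis 𝕜 E)]
  refine .of_nonneg_of_le (fun _ => by positivity) (fun i => ?_)
    ((hT.summable (someBasis 𝕜 E)).mul_left (‖L‖ ^ 2))
  rw [← mul_pow]
  gcongr
  exact L.le_opNorm _

lemma IsHilbertSchmidt.comp_right {T : F →L[𝕜] G} (hT : IsHilbertSchmidt T) (L : E →L[𝕜] F) :
    IsHilbertSchmidt (T ∘L L) := by
  rw [← isHilbertSchmidt_adjoint_iff, ContinuousLinearMap.adjoint_comp]
  exact ((isHilbertSchmidt_adjoint_iff T).2 hT).comp_left _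

/-- Bounded operators of finite rank are Hilbert--Schmidt. -/
lemma isHilbertSchmidt_of_finiteDimensional (T : E →L[𝕜] F) [FiniteDimensional 𝕜 T.range] :
    IsHilbertSchmidt T := by
  let b := someBasis 𝕜 E
  let f := stdOrthonormalBasis 𝕜 T.range
  rw [isHilbertSchmidt_iff b]
  -- Expanding in a finite orthonormal basis of the range leaves finitely many sums over `i`, each a
  -- Parseval sum for a vector `T* fⱼ`.
  have h : ∀ i, ‖T (b i)‖ ^ 2 = ∑ j, ‖inner 𝕜 (b i) (adjoint T (f j : F))‖ ^ 2 := by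
    intro i
    have := f.sum_sq_norm_inner_right ⟨T (b i), ⟨b i, rfl⟩⟩
    rw [Submodule.coe_norm] at this
    rw [← this]
    refine Finset.sum_congr rfl fun j _ => ?_
    rw [ContinuousLinearMap.adjoint_inner_right, norm_inner_symm]
    rfl
  simp_rw [h]
  refine summable_sum fun j _ => ?_
  rw [summable_iff_ofReal (fun _ => by positivity), tsum_sq_inner]
  exact ENNReal.ofReal_ne_top

lemma hsNorm_sq_eq_add {T : E →L[𝕜] F} {T₁ : E →L[𝕜] F} {T₂ : E →L[𝕜] F}
    (h₁ : IsHilbertSchmidt T₁) (h₂ : IsHilbertSchmidt T₂)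
    (h : ∀ x, ‖T x‖ ^ 2 = ‖T₁ x‖ ^ 2 + ‖T₂ x‖ ^ 2) :
    hsNorm T ^ 2 = hsNorm T₁ ^ 2 + hsNorm T₂ ^ 2 := by
  simp_rw [hsNorm_sq, h]
  exact (h₁.summable _).tsum_add (h₂.summable _)

lemma hsNorm_sq_proj_left {T : E →L[𝕜] F} (hT : IsHilbertSchmidt T) (K : Submodule 𝕜 F)
    [K.HasOrthogonalProjection] :
    hsNorm T ^ 2 =
      hsNorm (K.starProjection ∘L T) ^ 2 + hsNorm (T - K.starProjection ∘L T) ^ 2 := by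
  refine hsNorm_sq_eq_add (hT.comp_left _) (hT.sub (hT.comp_left _)) fun x => ?_
  have := Submodule.norm_sq_eq_add_norm_sq_starProjection (T x) K
  rwa [Submodule.starProjection_orthogonal_val] at this

lemma adjoint_starProjection (K : Submodule 𝕜 E) [K.HasOrthogonalProjection] :
    adjoint K.starProjection = K.starProjection :=
  (isSelfAdjoint_starProjection K).adjoint_eq

/-- Unlike for a projector on the left, Pythagoras fails vector by vector here; passing to adjoints
moves the projector to the left. -/
lemma hsNorm_sq_proj_right {T : E →L[𝕜] F} (hT : IsHilbertSchmidt T) (K : Submodule 𝕜 E)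
    [K.HasOrthogonalProjection] :
    hsNorm T ^ 2 =
      hsNorm (T ∘L K.starProjection) ^ 2 + hsNorm (T - T ∘L K.starProjection) ^ 2 := by
  have := hsNorm_sq_proj_left ((isHilbertSchmidt_adjoint_iff T).2 hT) K
  rwa [← hsNorm_adjoint T, ← hsNorm_adjoint (T ∘L K.starProjection),
    ← hsNorm_adjoint (T - T ∘L K.starProjection), map_sub, ContinuousLinearMap.adjoint_comp,
    adjoint_starProjection]

lemma eq_zero_of_hsNorm_eq_zero {T : E →L[𝕜] F} (hT : IsHilbertSchmidt T) (h : hsNorm T = 0) :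
    T = 0 := by
  let b := someBasis 𝕜 E
  have h0 : ∑' i, ‖T (b i)‖ ^ 2 = 0 := by rw [← hsNorm_sq, h]; simp
  have h1 := (hasSum_zero_iff_of_nonneg (fun _ => by positivity)).1
    (h0 ▸ (hT.summable b).hasSum)
  have hd : Dense ((Submodule.span 𝕜 (Set.range b) : Submodule 𝕜 E) : Set E) :=
    (Submodule.dense_iff_topologicalClosure_eq_top).2 b.dense_span
  refine ContinuousLinearMap.ext_on hd ?_
  rintro _ ⟨i, rfl⟩
  have := congrFun h1 i
  simpa using this

/-- Dominated convergence for the Hilbert--Schmidt norm. -/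
lemma tendsto_hsNorm_sub_comp_starProjection {R T : E →L[𝕜] F} (hR : IsHilbertSchmidt R)
    (hT : IsHilbertSchmidt T) (U : ℕ → Submodule 𝕜 E) [∀ n, (U n).HasOrthogonalProjection]
    (hU : ∀ y, Tendsto (fun n => (U n).starProjection (adjoint T y)) atTop (𝓝 (adjoint T y))) :
    Tendsto (fun n => hsNorm (R - T ∘L (U n).starProjection)) atTop (𝓝 (hsNorm (R - T))) := by
  -- After taking adjoints the projectors act on the fixed vectors `T* eⱼ`, so strong convergence
  -- gives convergence of each term, and contractivity of projectors gives a summable bound.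
  have e : ∀ n, hsNorm (R - T ∘L (U n).starProjection) =
      √(∑' j, ‖adjoint R (someBasis 𝕜 F j) -
        (U n).starProjection (adjoint T (someBasis 𝕜 F j))‖ ^ 2) := by
    intro n
    rw [← hsNorm_adjoint, map_sub, ContinuousLinearMap.adjoint_comp, adjoint_starProjection]
    rfl
  simp_rw [e]
  rw [← hsNorm_adjoint, map_sub]
  refine (Real.continuous_sqrt.tendsto _).comp ?_
  refine tendsto_tsum_of_dominated_convergence
    (((((isHilbertSchmidt_adjoint_iff R).2 hR).summable (someBasis 𝕜 F)).add
      (((isHilbertSchmidt_adjoint_iff T).2 hT).summable (someBasis 𝕜 F))).mul_left 2)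
    (fun j => ((tendsto_const_nhds.sub (hU _)).norm).pow 2) (.of_forall fun n j => ?_)
  rw [Real.norm_of_nonneg (by positivity)]
  refine (sq_norm_sub_le _ _).trans ?_
  gcongr
  exact Submodule.norm_starProjection_apply_le _ _

/-- Compressing the target of an approximation problem changes the squared error by a constant. -/
lemma exists_hsNorm_sq_sub_eq {M : E →L[𝕜] F} (hM : IsHilbertSchmidt M) (K : Submodule 𝕜 F)
    [K.HasOrthogonalProjection] (L : Submodule 𝕜 E) [L.HasOrthogonalProjection] :
    ∃ c : ℝ, ∀ S : E →L[𝕜] F, IsHilbertSchmidt S → K.starProjection ∘L S = S →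
      S ∘L L.starProjection = S →
      hsNorm (M - S) ^ 2 =
        hsNorm (K.starProjection ∘L M ∘L L.starProjection - S) ^ 2 + c := by
  -- The constant collects the parts of `M` that `S` cannot reach: `P_K M (1 - P_L)` and `(1 - P_K)
  -- M`.
  refine ⟨hsNorm (K.starProjection ∘L M - (K.starProjection ∘L M) ∘L L.starProjection) ^ 2 +
    hsNorm (M - K.starProjection ∘L M) ^ 2, fun S hS hK hL => ?_⟩
  rw [hsNorm_sq_proj_left (hM.sub hS) K, ContinuousLinearMap.comp_sub, hK,
    hsNorm_sq_proj_right ((hM.comp_left _).sub hS) L, ContinuousLinearMap.sub_comp, hL,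
    ContinuousLinearMap.comp_assoc, sub_sub_sub_cancel_right, sub_sub_sub_cancel_right, add_assoc]

end HilbertSchmidt

/-! ### Operators of rank at most `r`. -/

section Rank

variable {𝕜 E F G : Type*} [RCLike 𝕜]
  [NormedAddCommGroup E] [InnerProductSpace 𝕜 E]
  [NormedAddCommGroup F] [InnerProductSpace 𝕜 F]
  [NormedAddCommGroup G] [InnerProductSpace 𝕜 G]

/-- `F` and `G` may live in different universes, so the ranks are compared after lifting; a natural
number bound survives this. -/
lemma mem_boundedRankLE_of_range_le_map {T : E →L[𝕜] G} {W : Submodule 𝕜 F} {r : ℕ}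
    (hW : Module.rank 𝕜 W ≤ r) (f : F →ₗ[𝕜] G) (h : T.range ≤ W.map f) :
    T ∈ boundedRankLE 𝕜 E G r := by
  have h1 : Module.rank 𝕜 T.range ≤ Module.rank 𝕜 (W.map f) := Submodule.rank_mono h
  have h2 := lift_rank_map_le f W
  have h3 := h2.trans (Cardinal.lift_le.2 hW)
  rw [Cardinal.lift_natCast, Cardinal.lift_le_nat_iff] at h3
  exact h1.trans h3

lemma comp_left_mem_boundedRankLE {T : E →L[𝕜] F} {r : ℕ} (hT : T ∈ boundedRankLE 𝕜 E F r)
    (L : F →L[𝕜] G) : L ∘L T ∈ boundedRankLE 𝕜 E G r := by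
  refine mem_boundedRankLE_of_range_le_map (W := T.range) hT (L : F →ₗ[𝕜] G) ?_
  rintro _ ⟨x, rfl⟩
  exact ⟨T x, ⟨x, rfl⟩, rfl⟩

lemma comp_right_mem_boundedRankLE {T : F →L[𝕜] G} {r : ℕ} (hT : T ∈ boundedRankLE 𝕜 F G r)
    (L : E →L[𝕜] F) : T ∘L L ∈ boundedRankLE 𝕜 E G r := by
  refine mem_boundedRankLE_of_range_le_map (W := T.range) hT LinearMap.id ?_
  rintro _ ⟨x, rfl⟩
  exact ⟨T (L x), ⟨L x, rfl⟩, rfl⟩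

lemma finiteDimensional_range_of_mem_boundedRankLE {T : E →L[𝕜] F} {r : ℕ}
    (hT : T ∈ boundedRankLE 𝕜 E F r) : FiniteDimensional 𝕜 T.range := by
  have h : Module.rank 𝕜 T.range ≤ r := hT
  exact Module.rank_lt_aleph0_iff.1 (h.trans_lt (Cardinal.natCast_lt_aleph0 (n := r)))

end Rank

/-! ### Partially defined operators and their compositions. -/

section PartialMaps

variable {𝕜 E F G : Type*} [RCLike 𝕜]
  [NormedAddCommGroup E] [InnerProductSpace 𝕜 E]
  [NormedAddCommGroup F] [InnerProductSpace 𝕜 F]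
  [NormedAddCommGroup G] [InnerProductSpace 𝕜 G]

lemma eq_everywhere {f : E →ₗ.[𝕜] F} {T : E →L[𝕜] F}
    (h : ∀ x, ∃ hx : x ∈ f.domain, f ⟨x, hx⟩ = T x) : f = everywhere T := by
  have hd : f.domain = ⊤ := Submodule.eq_top_iff'.2 fun x => (h x).1
  refine LinearPMap.ext hd fun x hx hx' => ?_
  exact (h x).2

lemma mem_domain_everywhere (T : E →L[𝕜] F) (x : E) : x ∈ (everywhere T).domain :=
  Submodule.mem_top

lemma domain_pcomp_everywhere (T : F →L[𝕜] G) (R : E →ₗ.[𝕜] F) :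
    (pcomp (everywhere T) R).domain = R.domain := by
  ext x
  rw [mem_domain_pcomp]
  exact ⟨fun h => h.1, fun h => ⟨h, mem_domain_everywhere _ _⟩⟩

lemma pcomp_everywhere_apply (T : F →L[𝕜] G) (R : E →ₗ.[𝕜] F) {x : E}
    (hx : x ∈ (pcomp (everywhere T) R).domain) (h : x ∈ R.domain) :
    pcomp (everywhere T) R ⟨x, hx⟩ = T (R ⟨x, h⟩) := rfl

/-- If `g T = Z` everywhere, then `g (T R) = Z R` for each partially defined `R`. -/
lemma pcomp_pcomp_everywhere {H : Type*} [NormedAddCommGroup H] [InnerProductSpace 𝕜 H]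
    {g : G →ₗ.[𝕜] H} {T : F →L[𝕜] G} {Z : F →L[𝕜] H}
    (hZ : ∀ x, ∃ h : T x ∈ g.domain, g ⟨T x, h⟩ = Z x) (R : E →ₗ.[𝕜] F) :
    pcomp g (pcomp (everywhere T) R) = pcomp (everywhere Z) R := by
  have hd : (pcomp g (pcomp (everywhere T) R)).domain = (pcomp (everywhere Z) R).domain := by
    ext x
    rw [domain_pcomp_everywhere, mem_domain_pcomp]
    refine ⟨fun ⟨h, _⟩ => domain_pcomp_everywhere T R ▸ h, fun h => ?_⟩
    have hx : x ∈ (pcomp (everywhere T) R).domain := by rwa [domain_pcomp_everywhere]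
    refine ⟨hx, ?_⟩
    rw [pcomp_everywhere_apply T R hx h]
    exact (hZ _).1
  refine LinearPMap.ext hd fun x hx hx' => ?_
  have h : x ∈ R.domain := by rwa [domain_pcomp_everywhere] at hx'
  exact (hZ (R ⟨x, h⟩)).2

/-- Equality with an everywhere defined operator includes equality of domains, which forces `ran C ⊆
dom X`. -/
lemma exists_apply_of_pcomp_eq_everywhere {H : Type*} [NormedAddCommGroup H]
    [InnerProductSpace 𝕜 H] {B : G →L[𝕜] H} {X : F →ₗ.[𝕜] G} {C : E →L[𝕜] F} {S : E →L[𝕜] H}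
    (h : pcomp (everywhere B) (pcomp X (everywhere C)) = everywhere S) (x : E) :
    ∃ hx : C x ∈ X.domain, S x = B (X ⟨C x, hx⟩) := by
  have hx : x ∈ (pcomp (everywhere B) (pcomp X (everywhere C))).domain := by
    rw [h]; exact mem_domain_everywhere _ _
  have hx' := hx
  rw [domain_pcomp_everywhere] at hx'
  obtain ⟨h1, h2⟩ := mem_domain_pcomp.1 hx'
  refine ⟨h2, ?_⟩
  have e : ∀ {f g : E →ₗ.[𝕜] H} (_ : f = g) (h1 : x ∈ f.domain) (h2 : x ∈ g.domain),
      f ⟨x, h1⟩ = g ⟨x, h2⟩ := by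
    rintro f _ rfl _ _; rfl
  exact (e h hx (mem_domain_everywhere S x)).symm

/-- The values of `LinearPMap.inverse` are meaningful only for an injective map, hence `hinj`. -/
lemma invExtZero_apply {T : E →L[𝕜] F} {U : Submodule 𝕜 E} {V : Submodule 𝕜 F}
    (hUV : ∀ x ∈ U, T x ∈ V) (hinj : ∀ x ∈ U, T x = 0 → x = 0) {x : E} (hx : x ∈ U) {k : F}
    (hk : k ∈ Vᗮ) : ∃ h : T x + k ∈ (invExtZero T U V hUV).domain,
      invExtZero T U V hUV ⟨T x + k, h⟩ = x := by
  have hker : ((T : E →ₗ[𝕜] F).toPMap U).toFun.ker = ⊥ := by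
    rw [LinearMap.ker_eq_bot']
    rintro ⟨y, hy⟩ hTy
    exact Subtype.ext (hinj y hy hTy)
  have hTx : T x ∈ (((T : E →ₗ[𝕜] F).toPMap U).inverse).domain := by
    rw [LinearPMap.inverse_domain]
    exact ⟨⟨x, hx⟩, rfl⟩
  have h : T x + k ∈ (invExtZero T U V hUV).domain :=
    Submodule.add_mem_sup hTx hk
  refine ⟨h, (LinearPMap.sup_apply (f := ((T : E →ₗ[𝕜] F).toPMap U).inverse)
    (g := (0 : F →ₗ[𝕜] E).toPMap Vᗮ) _ ⟨T x, hTx⟩ ⟨k, hk⟩ ⟨T x + k, h⟩ rfl).trans ?_⟩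
  rw [LinearPMap.inverse_apply_eq hker (x := ⟨x, hx⟩) rfl]
  simp

end PartialMaps

/-! ### The Moore--Penrose inverse. -/

section MoorePenrose

variable {𝕜 E F G : Type*} [RCLike 𝕜]
  [NormedAddCommGroup E] [InnerProductSpace 𝕜 E] [CompleteSpace E]
  [NormedAddCommGroup F] [InnerProductSpace 𝕜 F]
  [NormedAddCommGroup G] [InnerProductSpace 𝕜 G]

lemma apply_projKerPerp (T : E →L[𝕜] F) (x : E) : T (projKerPerp T x) = T x := by
  have h : x - projKerPerp T x ∈ T.ker := by
    have := Submodule.sub_starProjection_mem_orthogonal (K := (T.ker)ᗮ) x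
    rwa [Submodule.orthogonal_orthogonal] at this
  have h2 : T (x - projKerPerp T x) = 0 := h
  rw [map_sub, sub_eq_zero] at h2
  exact h2.symm

lemma projKerPerp_mem (T : E →L[𝕜] F) (x : E) : projKerPerp T x ∈ (T.ker)ᗮ :=
  Submodule.starProjection_apply_mem _ _

/-- `T†(T x + k)` is the component of `x` orthogonal to `ker T`. -/
lemma mpInv_apply_add (T : E →L[𝕜] F) (x : E) {k : F} (hk : k ∈ (T.range)ᗮ)
    (h : T x + k ∈ (mpInv T).domain) : mpInv T ⟨T x + k, h⟩ = projKerPerp T x := by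
  have h' : T (projKerPerp T x) + k ∈ (mpInv T).domain := by rwa [apply_projKerPerp]
  rw [← mpInv_apply T (projKerPerp_mem T x) hk h']
  congr 2
  rw [apply_projKerPerp]

lemma mem_domain_mpInv (T : E →L[𝕜] F) (x : E) : T x ∈ (mpInv T).domain := by
  rw [mpInv_domain]
  exact Submodule.mem_sup_left ⟨x, rfl⟩

lemma mpInv_apply_apply (T : E →L[𝕜] F) (x : E) (h : T x ∈ (mpInv T).domain) :
    mpInv T ⟨T x, h⟩ = projKerPerp T x := by
  have h' : T x + 0 ∈ (mpInv T).domain := by rwa [add_zero]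
  rw [← mpInv_apply_add T x (Submodule.zero_mem _) h']
  congr 2
  rw [add_zero]

/-- The composition `B† Y` is a bounded operator if `Y` has finite rank and maps into `ran B`. -/
lemma exists_mpInv_comp (B : E →L[𝕜] F) {Y : G →L[𝕜] F} {r : ℕ}
    (hr : Y ∈ boundedRankLE 𝕜 G F r) (hY : Y.range ≤ B.range) :
    ∃ Z : G →L[𝕜] E, (∀ x, ∃ h : Y x ∈ (mpInv B).domain, mpInv B ⟨Y x, h⟩ = Z x) ∧
      B ∘L Z = Y ∧ Z ∈ boundedRankLE 𝕜 G E r ∧ projKerPerp B ∘L Z = Z := by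
  have hd : Y.range ≤ (mpInv B).domain := by
    rw [mpInv_domain]; exact hY.trans le_sup_left
  have := finiteDimensional_range_of_mem_boundedRankLE hr
  -- `B†` may be unbounded, but on the finite-dimensional space `ran Y` every linear map is
  -- continuous.
  let g : Y.range →L[𝕜] E :=
    LinearMap.toContinuousLinearMap ((mpInv B).toFun ∘ₗ Submodule.inclusion hd)
  let Y' : G →L[𝕜] Y.range := Y.codRestrict Y.range fun x => ⟨x, rfl⟩
  have hZ : ∀ x, (g ∘L Y') x = mpInv B ⟨Y x, hd ⟨x, rfl⟩⟩ := fun x => rfl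
  have hp : ∀ x, ∃ z, B z = Y x ∧ (g ∘L Y') x = projKerPerp B z := by
    intro x
    obtain ⟨z, hz⟩ := hY ⟨x, rfl⟩
    have hz' : B z = Y x := hz
    refine ⟨z, hz', ?_⟩
    rw [hZ, ← mpInv_apply_apply B z (mem_domain_mpInv B z)]
    congr 2
    exact hz'.symm
  refine ⟨g ∘L Y', fun x => ⟨hd ⟨x, rfl⟩, (hZ x).symm⟩, ?_, ?_, ?_⟩
  · ext x
    obtain ⟨z, hz, hz'⟩ := hp x
    rw [ContinuousLinearMap.comp_apply, hz', apply_projKerPerp, hz]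
  · refine comp_left_mem_boundedRankLE (mem_boundedRankLE_of_range_le_map (F := Y.range)
      (W := ⊤) ?_ LinearMap.id ?_) g
    · rw [rank_top]; exact hr
    · rw [Submodule.map_id]; exact le_top
  · ext x
    obtain ⟨z, hz, hz'⟩ := hp x
    rw [ContinuousLinearMap.comp_apply, hz']
    exact Submodule.starProjection_eq_self_iff.2 (projKerPerp_mem B z)

end MoorePenrose

/-! ### The outer inverses and the projectors onto `C* V`. -/

section OuterInverse

variable {𝕜 E F : Type*} [RCLike 𝕜]
  [NormedAddCommGroup E] [InnerProductSpace 𝕜 E] [CompleteSpace E]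
  [NormedAddCommGroup F] [InnerProductSpace 𝕜 F] [CompleteSpace F]

/-- `ker C* = (ran C)ᗮ` meets the closure of `ran C` only in `0`. This makes `C*` injective on `V`,
so that `C* V` and `V` have equal dimension. -/
lemma adjoint_eq_zero_of_mem_closure_range (C : E →L[𝕜] F) {v : F}
    (hv : v ∈ C.range.topologicalClosure) (h : adjoint C v = 0) : v = 0 := by
  have h1 : v ∈ (C.range)ᗮ := by rw [ContinuousLinearMap.orthogonal_range]; exact h
  rw [← Submodule.orthogonal_orthogonal_eq_closure] at hv
  exact Submodule.disjoint_def.1 (Submodule.orthogonal_disjoint _) v h1 hv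

/-- If `x = C* v` with `v ∈ V` and `C x ⊥ V`, then `‖x‖² = ⟨v, C x⟩ = 0`. -/
lemma starProjection_comp_injOn (C : E →L[𝕜] F) (V : Submodule 𝕜 F) [FiniteDimensional 𝕜 V]
    (x : E) (hx : x ∈ V.map (adjoint C : F →ₗ[𝕜] E)) (h : (V.starProjection ∘L C) x = 0) :
    x = 0 := by
  obtain ⟨v, hv, rfl⟩ := hx
  have h1 : V.starProjection (C (adjoint C v)) = 0 := h
  rw [Submodule.starProjection_apply_eq_zero_iff] at h1
  have h2 := h1 v hv
  rw [← ContinuousLinearMap.adjoint_inner_left] at h2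
  exact inner_self_eq_zero.1 h2

/-- For `V` inside the closure of `ran C`, the outer inverse `C_V^#` is bounded, everywhere
defined, factors through the projector onto `V`, and `C_V^# C` is the projector onto `C* V`. -/
lemma exists_outerInv_eq_everywhere (C : E →L[𝕜] F) (V : Submodule 𝕜 F) [FiniteDimensional 𝕜 V]
    (hV : V ≤ C.range.topologicalClosure) :
    ∃ D : F →L[𝕜] E, outerInv C V = everywhere D ∧ D ∘L V.starProjection = D ∧
      ∀ x, D (C x) = (V.map (adjoint C : F →ₗ[𝕜] E)).starProjection x := by
  let U := V.map (adjoint C : F →ₗ[𝕜] E)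
  let A := V.starProjection ∘L C
  have hA : ∀ x, A x ∈ V := fun x => Submodule.starProjection_apply_mem _ _
  have hinjA : ∀ x ∈ U, A x = 0 → x = 0 := starProjection_comp_injOn C V
  let f : U →ₗ[𝕜] V := (A : E →ₗ[𝕜] F).restrict fun x _ => hA x
  have hf : Function.Injective f := by
    rw [← LinearMap.ker_eq_bot, LinearMap.ker_eq_bot']
    rintro ⟨x, hx⟩ h
    exact Subtype.ext (hinjA x hx (congrArg Subtype.val h))
  have hrank : Module.finrank 𝕜 U = Module.finrank 𝕜 V := by
    have hinj : Function.Injective ((adjoint C : F →ₗ[𝕜] E).domRestrict V) := by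
      rw [← LinearMap.ker_eq_bot, LinearMap.ker_eq_bot']
      rintro ⟨v, hv⟩ h
      exact Subtype.ext (adjoint_eq_zero_of_mem_closure_range C (hV hv) h)
    rw [← LinearMap.finrank_range_of_inj hinj, LinearMap.range_domRestrict]
  let e : U ≃ₗ[𝕜] V := LinearEquiv.ofInjectiveOfFinrankEq f hf hrank
  have he : ∀ u, (e u : F) = A u := fun u => rfl
  let D : F →L[𝕜] E :=
    U.subtypeL ∘L LinearMap.toContinuousLinearMap (e.symm : V →ₗ[𝕜] U) ∘L V.orthogonalProjectionOnto
  have hDmem : ∀ y, D y ∈ U := fun y => (e.symm (V.orthogonalProjectionOnto y)).2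
  have hAD : ∀ y, A (D y) = V.starProjection y := by
    intro y
    change A (e.symm (V.orthogonalProjectionOnto y) : E) = _
    rw [← he, LinearEquiv.apply_symm_apply]
    rfl
  refine ⟨D, eq_everywhere fun y => ?_, ?_, fun x => ?_⟩
  · obtain ⟨h, hh⟩ := invExtZero_apply (fun x _ => hA x) hinjA (hDmem y)
      (Submodule.sub_starProjection_mem_orthogonal (K := V) y)
    have e1 : A (D y) + (y - V.starProjection y) = y := by rw [hAD]; abel
    have hy : y ∈ (outerInv C V).domain := by
      have := h
      rwa [e1] at this
    refine ⟨hy, Eq.trans ?_ hh⟩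
    change outerInv C V _ = outerInv C V _
    congr 2
    exact e1.symm
  · ext y
    change (e.symm (V.orthogonalProjectionOnto (V.starProjection y)) : E) =
      e.symm (V.orthogonalProjectionOnto y)
    rw [Submodule.orthogonalProjectionOnto_starProjection_of_le le_rfl]
  -- Since `A D = P_V`, the vector `C (x - D C x)` is orthogonal to `V`; moving `C` across the inner
  -- product, `x - D C x` is orthogonal to `C* V`.
  · refine (Submodule.eq_starProjection_of_mem_of_inner_eq_zero (hDmem _) ?_).symm
    rintro _ ⟨v, hv, rfl⟩
    have h1 : A (x - D (C x)) = 0 := by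
      rw [map_sub, hAD]
      exact sub_self _
    have h2 : V.starProjection (C (x - D (C x))) = 0 := h1
    rw [Submodule.starProjection_apply_eq_zero_iff] at h2
    have h3 := (Submodule.mem_orthogonal' V _).1 h2 v hv
    rwa [← ContinuousLinearMap.adjoint_inner_right] at h3

/-- The projectors onto `C* Vₙ` converge strongly to the projector onto `(ker C)ᗮ`. -/
lemma tendsto_starProjection_map_adjoint (C : E →L[𝕜] F) (V : ℕ → Submodule 𝕜 F)
    [∀ n, FiniteDimensional 𝕜 (V n)] (hmono : Monotone V)
    (hV : C.range ≤ (⨆ n, V n).topologicalClosure) (x : E) :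
    Tendsto (fun n => ((V n).map (adjoint C : F →ₗ[𝕜] E)).starProjection x) atTop
      (𝓝 (projKerPerp C x)) := by
  have h := Submodule.starProjection_tendsto_closure_iSup
    (fun n => (V n).map (adjoint C : F →ₗ[𝕜] E)) (fun m n hmn => Submodule.map_mono (hmono hmn)) x
  -- It suffices to compare orthogonal complements. If `y ⊥ C* Vₙ` for all `n`, then `C y` is
  -- orthogonal to every `Vₙ` but lies in the closure of their span, so `C y = 0`.
  have e : (⨆ n, (V n).map (adjoint C : F →ₗ[𝕜] E)).topologicalClosure = (C.ker)ᗮ := by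
    rw [← Submodule.orthogonal_orthogonal_eq_closure, ← Submodule.map_iSup]
    congr 1
    ext y
    rw [Submodule.mem_orthogonal]
    constructor
    · intro hy
      have h1 : C y ∈ (⨆ n, V n)ᗮ := by
        intro v hv
        rw [← ContinuousLinearMap.adjoint_inner_left]
        exact hy _ ⟨v, hv, rfl⟩
      have h2 : C y ∈ (⨆ n, V n)ᗮᗮ := by
        rw [Submodule.orthogonal_orthogonal_eq_closure]
        exact hV ⟨y, rfl⟩
      exact Submodule.disjoint_def.1 (Submodule.orthogonal_disjoint _) _ h1 h2
    · rintro hy _ ⟨v, hv, rfl⟩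
      have hy' : C y = 0 := hy
      change inner 𝕜 (adjoint C v) y = 0
      rw [ContinuousLinearMap.adjoint_inner_left, hy', inner_zero_right]
  unfold projKerPerp
  simp_rw [← e]
  exact h

end OuterInverse

/-- An exhausting sequence of finite-dimensional subspaces of a separable subspace. -/
lemma exists_monotone_finiteDimensional {𝕜 F : Type*} [RCLike 𝕜]
    [NormedAddCommGroup F] [InnerProductSpace 𝕜 F] [TopologicalSpace.SeparableSpace F]
    (K : Submodule 𝕜 F) :
    ∃ V : ℕ → Submodule 𝕜 F, (∀ n, FiniteDimensional 𝕜 (V n)) ∧ Monotone V ∧ (∀ n, V n ≤ K) ∧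
      closure (⋃ n, (V n : Set F)) = closure K := by
  have : Nonempty K := ⟨0⟩
  have : SecondCountableTopology F := UniformSpace.secondCountable_of_separable F
  let d := TopologicalSpace.denseSeq K
  let s : ℕ → Set F := fun n => (fun i => (d i : F)) '' Set.Iio n
  have hs : ∀ n, Submodule.span 𝕜 (s n) ≤ K := by
    intro n
    rw [Submodule.span_le]
    rintro _ ⟨i, _, rfl⟩
    exact (d i).2
  refine ⟨fun n => Submodule.span 𝕜 (s n), fun n => ?_, fun m n hmn => ?_, hs, ?_⟩
  · exact FiniteDimensional.span_of_finite 𝕜 ((Set.finite_Iio n).image _)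
  · exact Submodule.span_mono (Set.image_mono (Set.Iio_subset_Iio hmn))
  · refine (closure_mono (Set.iUnion_subset hs)).antisymm ?_
    refine closure_minimal ?_ isClosed_closure
    have h1 : Set.range (fun i => (d i : F)) ⊆ ⋃ n, (Submodule.span 𝕜 (s n) : Set F) := by
      rintro _ ⟨i, rfl⟩
      exact Set.mem_iUnion.2 ⟨i + 1, Submodule.subset_span ⟨i, Nat.lt_succ_self i, rfl⟩⟩
    refine subset_trans ?_ (closure_mono h1)
    intro x hx
    have := (TopologicalSpace.denseRange_denseSeq K) ⟨x, hx⟩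
    have h2 := image_closure_subset_closure_image continuous_subtype_val
      (Set.mem_image_of_mem Subtype.val this)
    rwa [← Set.range_comp] at h2

/-! ### Best approximations and the bounded approximants. -/

section Optimality

variable {𝕜 H₁ H₂ H₃ H₄ : Type*} [RCLike 𝕜]
  [NormedAddCommGroup H₁] [InnerProductSpace 𝕜 H₁]
  [NormedAddCommGroup H₂] [InnerProductSpace 𝕜 H₂]
  [NormedAddCommGroup H₃] [InnerProductSpace 𝕜 H₃]
  [NormedAddCommGroup H₄] [InnerProductSpace 𝕜 H₄]

lemma isHilbertSchmidt_of_mem_boundedRankLE [CompleteSpace H₁] [CompleteSpace H₄]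
    {T : H₁ →L[𝕜] H₄} {r : ℕ}
    (hT : T ∈ boundedRankLE 𝕜 H₁ H₄ r) : IsHilbertSchmidt T :=
  have := finiteDimensional_range_of_mem_boundedRankLE hT
  isHilbertSchmidt_of_finiteDimensional T

lemma isHilbertSchmidt_projected [CompleteSpace H₁] [CompleteSpace H₄]
    {M : H₁ →L[𝕜] H₄} (hM : IsHilbertSchmidt M) (B : H₃ →L[𝕜] H₄)
    (C : H₁ →L[𝕜] H₂) : IsHilbertSchmidt (projected M B C) :=
  (hM.comp_right _).comp_left _

lemma projRan_comp_projected [CompleteSpace H₁] [CompleteSpace H₄]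
    (M : H₁ →L[𝕜] H₄) (B : H₃ →L[𝕜] H₄) (C : H₁ →L[𝕜] H₂) :
    projRan B ∘L projected M B C = projected M B C := by
  ext x
  exact Submodule.starProjection_eq_self_iff.2 (Submodule.starProjection_apply_mem _ _)

lemma projected_comp_projKerPerp [CompleteSpace H₁] [CompleteSpace H₄]
    (M : H₁ →L[𝕜] H₄) (B : H₃ →L[𝕜] H₄) (C : H₁ →L[𝕜] H₂) :
    projected M B C ∘L projKerPerp C = projected M B C := by
  ext x
  change projRan B (M (projKerPerp C (projKerPerp C x))) = projRan B (M (projKerPerp C x))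
  congr 2
  exact Submodule.starProjection_eq_self_iff.2 (projKerPerp_mem C x)

lemma comp_projKerPerp_eq [CompleteSpace H₁] {C : H₁ →L[𝕜] H₂} {S : H₁ →L[𝕜] H₄}
    (h : ∀ x, C x = 0 → S x = 0) :
    S ∘L projKerPerp C = S := by
  ext x
  have h1 : S (projKerPerp C x - x) = 0 := h _ (by rw [map_sub, apply_projKerPerp, sub_self])
  rwa [map_sub, sub_eq_zero] at h1

lemma projRan_comp_eq [CompleteSpace H₄] {B : H₃ →L[𝕜] H₄} {S : H₁ →L[𝕜] H₄}
    (h : S.range ≤ B.range) :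
    projRan B ∘L S = S := by
  ext x
  exact Submodule.starProjection_eq_self_iff.2 (B.range.le_topologicalClosure (h ⟨x, rfl⟩))

variable {M : H₁ →L[𝕜] H₄} {B : H₃ →L[𝕜] H₄} {C : H₁ →L[𝕜] H₂} {r : ℕ} {Y : H₁ →L[𝕜] H₄}

/-- A best approximation of `projected M B C` maps into the closure of `ran B`. -/
lemma projRan_comp_of_mem_classY [CompleteSpace H₁] [CompleteSpace H₄]
    (hM : IsHilbertSchmidt M) (hY : Y ∈ classY M B C r) :
    projRan B ∘L Y = Y := by
  obtain ⟨hr, -, hmin⟩ := hY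
  have hYhs := isHilbertSchmidt_of_mem_boundedRankLE hr
  have h1 := hsNorm_sq_proj_left ((isHilbertSchmidt_projected hM B C).sub hYhs)
    B.range.topologicalClosure
  change _ = hsNorm (projRan B ∘L _) ^ 2 + hsNorm (_ - projRan B ∘L _) ^ 2 at h1
  rw [ContinuousLinearMap.comp_sub, projRan_comp_projected, sub_sub_sub_cancel_left] at h1
  -- The competitor `P Y` has squared error smaller by exactly `‖P Y - Y‖²`, so minimality makes
  -- this term vanish.
  have h2 := hmin _ (comp_left_mem_boundedRankLE hr (projRan B))
  have h3 : hsNorm (projRan B ∘L Y - Y) = 0 := by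
    nlinarith [hsNorm_nonneg (projected M B C - Y), hsNorm_nonneg (projRan B ∘L Y - Y)]
  exact sub_eq_zero.1 (eq_zero_of_hsNorm_eq_zero ((hYhs.comp_left _).sub hYhs) h3)

/-- A best approximation of `projected M B C` vanishes on `ker C`. -/
lemma comp_projKerPerp_of_mem_classY [CompleteSpace H₁] [CompleteSpace H₄]
    (hM : IsHilbertSchmidt M) (hY : Y ∈ classY M B C r) :
    Y ∘L projKerPerp C = Y := by
  obtain ⟨hr, -, hmin⟩ := hY
  have hYhs := isHilbertSchmidt_of_mem_boundedRankLE hr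
  have h1 := hsNorm_sq_proj_right ((isHilbertSchmidt_projected hM B C).sub hYhs) (C.ker)ᗮ
  change _ = hsNorm (_ ∘L projKerPerp C) ^ 2 + hsNorm (_ - _ ∘L projKerPerp C) ^ 2 at h1
  rw [ContinuousLinearMap.sub_comp, projected_comp_projKerPerp, sub_sub_sub_cancel_left] at h1
  have h2 := hmin _ (comp_right_mem_boundedRankLE hr (projKerPerp C))
  have h3 : hsNorm (Y ∘L projKerPerp C - Y) = 0 := by
    nlinarith [hsNorm_nonneg (projected M B C - Y), hsNorm_nonneg (Y ∘L projKerPerp C - Y)]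
  exact sub_eq_zero.1 (eq_zero_of_hsNorm_eq_zero ((hYhs.comp_right _).sub hYhs) h3)

/-- Membership in `dom B†` leaves a component `k ∈ (ran B)ᗮ`; as `Y x` lies in the closure of `ran
B`, so does `k`, hence `k = 0`. -/
lemma range_le_range_of_mem_classY [CompleteSpace H₁] [CompleteSpace H₃] [CompleteSpace H₄]
    (hM : IsHilbertSchmidt M) (hY : Y ∈ classY M B C r) :
    Y.range ≤ B.range := by
  rintro _ ⟨x, rfl⟩
  have h1 : Y x ∈ B.range ⊔ (B.range)ᗮ := by rw [← mpInv_domain]; exact hY.2.1 ⟨x, rfl⟩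
  obtain ⟨b, hb, k, hk, e⟩ := Submodule.mem_sup.1 h1
  have h2 : Y x ∈ B.range.topologicalClosure := by
    rw [← projRan_comp_of_mem_classY hM hY]
    exact Submodule.starProjection_apply_mem _ _
  have h3 : k ∈ B.range.topologicalClosure := by
    have : k = Y x - b := by rw [← e]; abel
    rw [this]
    exact sub_mem h2 (B.range.le_topologicalClosure hb)
  rw [← Submodule.orthogonal_orthogonal_eq_closure] at h3
  have h4 : k = 0 := Submodule.disjoint_def.1 (Submodule.orthogonal_disjoint _) k hk h3
  change Y x ∈ _
  rw [← e, h4, add_zero]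
  exact hb

/-- `Y` is optimal among all rank-`r` operators which vanish on `ker C` and map into `ran B`. -/
lemma hsNorm_sub_le_of_mem_classY [CompleteSpace H₁] [CompleteSpace H₄]
    (hM : IsHilbertSchmidt M) (hY : Y ∈ classY M B C r)
    {S : H₁ →L[𝕜] H₄} (hr : S ∈ boundedRankLE 𝕜 H₁ H₄ r) (hker : ∀ x, C x = 0 → S x = 0)
    (hran : S.range ≤ B.range) : hsNorm (M - Y) ≤ hsNorm (M - S) := by
  obtain ⟨c, hc⟩ := exists_hsNorm_sq_sub_eq hM B.range.topologicalClosure (C.ker)ᗮ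
  have h1 := hc Y (isHilbertSchmidt_of_mem_boundedRankLE hY.1) (projRan_comp_of_mem_classY hM hY)
    (comp_projKerPerp_of_mem_classY hM hY)
  have h2 := hc S (isHilbertSchmidt_of_mem_boundedRankLE hr) (projRan_comp_eq hran)
    (comp_projKerPerp_eq hker)
  change _ = hsNorm (projected M B C - Y) ^ 2 + c at h1
  change _ = hsNorm (projected M B C - S) ^ 2 + c at h2
  refine (sq_le_sq₀ (hsNorm_nonneg _) (hsNorm_nonneg _)).1 ?_
  rw [h1, h2]
  gcongr
  · exact hsNorm_nonneg _
  · exact hY.2.2 S hr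

/-- The bounded approximations `X̂ₙ` along an exhausting sequence of subspaces. -/
lemma exists_bounded_approx [CompleteSpace H₁] [CompleteSpace H₂] [CompleteSpace H₃]
    [CompleteSpace H₄]
    {Z : H₁ →L[𝕜] H₃} (hZr : Z ∈ boundedRankLE 𝕜 H₁ H₃ r)
    (hZ : ∀ x, ∃ h : Y x ∈ (mpInv B).domain, mpInv B ⟨Y x, h⟩ = Z x) (hBZ : B ∘L Z = Y)
    (hZB : projKerPerp B ∘L Z = Z) (hYhs : IsHilbertSchmidt Y) (hYC : Y ∘L projKerPerp C = Y)
    (V : ℕ → Submodule 𝕜 H₂) [∀ n, FiniteDimensional 𝕜 (V n)] (hmono : Monotone V)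
    (hVC : ∀ n, V n ≤ C.range.topologicalClosure)
    (hV : closure (⋃ n, (V n : Set H₂)) = closure (Set.range C)) :
    ∃ X : ℕ → H₂ →L[𝕜] H₃,
      (∀ n, hatXApprox B C Y (V n) = everywhere (X n)) ∧
      (∀ n, X n ∈ boundedRankLE 𝕜 H₂ H₃ r) ∧
      (∀ h : (hatX B C Y).domain,
        Tendsto (fun n => X n (h : H₂)) atTop (𝓝 (hatX B C Y h))) ∧
      (∀ n, IsHilbertSchmidt (B ∘L X n ∘L C)) ∧
      (∀ R : H₁ →L[𝕜] H₄, IsHilbertSchmidt R →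
        Tendsto (fun n => hsNorm (R - B ∘L X n ∘L C)) atTop (𝓝 (hsNorm (R - Y)))) ∧
      (∀ n, projKerPerp B ∘L X n ∘L projRan C = X n) := by
  choose D hD hDV hDC using fun n => exists_outerInv_eq_everywhere C (V n) (hVC n)
  have hrange : C.range ≤ (⨆ n, V n).topologicalClosure := by
    intro y hy
    have h1 : y ∈ closure (⋃ n, (V n : Set H₂)) := by rw [hV]; exact subset_closure hy
    rw [← SetLike.mem_coe, Submodule.topologicalClosure_coe]
    exact closure_mono (Set.iUnion_subset fun n => le_iSup V n) h1
  have hlim := tendsto_starProjection_map_adjoint C V hmono hrange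
  have hBX : ∀ n, B ∘L (Z ∘L D n) ∘L C =
      Y ∘L ((V n).map (adjoint C : H₂ →ₗ[𝕜] H₁)).starProjection := by
    intro n
    ext x
    change B (Z (D n (C x))) = Y _
    rw [hDC, ← hBZ]
    rfl
  refine ⟨fun n => Z ∘L D n, fun n => ?_, fun n => comp_right_mem_boundedRankLE hZr _, ?_,
    fun n => ?_, fun R hR => ?_, fun n => ?_⟩
  · rw [hatXApprox, pcomp_pcomp_everywhere hZ, hD]
    refine eq_everywhere fun x => ?_
    have hx : x ∈ (pcomp (everywhere Z) (everywhere (D n))).domain := by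
      rw [domain_pcomp_everywhere]; exact mem_domain_everywhere _ _
    exact ⟨hx, rfl⟩
  · rw [show hatX B C Y = _ from pcomp_pcomp_everywhere hZ _]
    rintro ⟨h, hh'⟩
    have hh1 := hh'
    rw [domain_pcomp_everywhere] at hh1
    rw [pcomp_everywhere_apply Z _ hh' hh1]
    have hh2 := hh1
    rw [mpInv_domain] at hh2
    obtain ⟨_, ⟨x, rfl⟩, k, hk, rfl⟩ := Submodule.mem_sup.1 hh2
    change Tendsto (fun n => Z (D n (C x + k))) atTop (𝓝 (Z (mpInv C ⟨C x + k, hh1⟩)))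
    rw [mpInv_apply_add C x hk hh1]
    -- `Vₙ` lies in the closure of `ran C`, so the component `k` is invisible to `C_n^#`, just as it
    -- is to `C†`; the strong convergence of the projectors at `x` remains.
    have hk0 : ∀ n, D n k = 0 := by
      intro n
      have h1 : k ∈ (V n)ᗮ := by
        refine Submodule.orthogonal_le (hVC n) ?_
        rwa [Submodule.orthogonal_closure]
      rw [← hDV n, ContinuousLinearMap.comp_apply,
        (Submodule.starProjection_apply_eq_zero_iff _).2 h1, map_zero]
    simp only [map_add, hk0, hDC, add_zero]
    exact (Z.continuous.tendsto _).comp (hlim x)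
  · rw [hBX]
    exact hYhs.comp_right _
  · simp_rw [hBX]
    refine tendsto_hsNorm_sub_comp_starProjection hR hYhs _ fun y => ?_
    -- `Y Q = Y` puts `ran Y*` inside `(ker C)ᗮ`, where the projectors converge to the identity.
    have h1 : projKerPerp C (adjoint Y y) = adjoint Y y := by
      conv_rhs => rw [← hYC, ContinuousLinearMap.adjoint_comp]
      rw [projKerPerp, adjoint_starProjection]
      rfl
    have h2 := hlim (adjoint Y y)
    rwa [h1] at h2
  · have h1 : D n ∘L projRan C = D n := by
      rw [← hDV n, ContinuousLinearMap.comp_assoc]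
      congr 1
      exact Submodule.starProjection_comp_starProjection_of_le (hVC n)
    rw [ContinuousLinearMap.comp_assoc, h1, ← ContinuousLinearMap.comp_assoc, hZB]

end Optimality

end RankApprox

end

/-! ### The main theorem. -/

theorem mainTheorem8 {𝕜 : Type*} [RCLike 𝕜] {H₁ H₂ H₃ H₄ : Type*}
    [NormedAddCommGroup H₁] [InnerProductSpace 𝕜 H₁] [CompleteSpace H₁]
    [TopologicalSpace.SeparableSpace H₁]
    [NormedAddCommGroup H₂] [InnerProductSpace 𝕜 H₂] [CompleteSpace H₂]
    [TopologicalSpace.SeparableSpace H₂]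
    [NormedAddCommGroup H₃] [InnerProductSpace 𝕜 H₃] [CompleteSpace H₃]
    [TopologicalSpace.SeparableSpace H₃]
    [NormedAddCommGroup H₄] [InnerProductSpace 𝕜 H₄] [CompleteSpace H₄]
    [TopologicalSpace.SeparableSpace H₄]
    (r : ℕ) (M : H₁ →L[𝕜] H₄) (hM : RankApprox.IsHilbertSchmidt M)
    (B : H₃ →L[𝕜] H₄) (C : H₁ →L[𝕜] H₂)
    (Y : H₁ →L[𝕜] H₄) (hY : Y ∈ RankApprox.classY M B C r) :
    ∃ S : H₁ →L[𝕜] H₄,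
      -- `S = B X̂ C`, and `X̂` is an element of `𝒳_r` with domain `dom C†`
      RankApprox.pcomp (RankApprox.everywhere B)
          (RankApprox.pcomp (RankApprox.hatX B C Y) (RankApprox.everywhere C)) =
        RankApprox.everywhere S ∧
      RankApprox.IsHilbertSchmidt S ∧
      RankApprox.hatX B C Y ∈ RankApprox.classX B C r ∧
      (RankApprox.hatX B C Y).domain = (RankApprox.mpInv C).domain ∧
      -- the bounded approximations
      (∀ (V : ℕ → Submodule 𝕜 H₂) [∀ n, FiniteDimensional 𝕜 (V n)],
        Monotone V →
        (∀ n, V n ≤ C.range.topologicalClosure) →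
        closure (⋃ n, (V n : Set H₂)) = closure (Set.range C) →
        ∃ X : ℕ → H₂ →L[𝕜] H₃,
          (∀ n, RankApprox.hatXApprox B C Y (V n) = RankApprox.everywhere (X n)) ∧
          (∀ n, X n ∈ RankApprox.boundedRankLE 𝕜 H₂ H₃ r) ∧
          (∀ h : (RankApprox.hatX B C Y).domain,
            Tendsto (fun n => X n (h : H₂)) atTop (𝓝 (RankApprox.hatX B C Y h))) ∧
          (∀ n, RankApprox.IsHilbertSchmidt (B ∘L X n ∘L C)) ∧
          Tendsto (fun n => RankApprox.hsNorm (B ∘L X n ∘L C - S)) atTop (𝓝 0) ∧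
          (∀ n, RankApprox.projKerPerp B ∘L X n ∘L RankApprox.projRan C = X n)) ∧
      -- the minimum of the unbounded problem equals the infimum of the bounded problem
      IsLeast (RankApprox.errorsX M B C r) (RankApprox.hsNorm (M - S)) ∧
      IsGLB (RankApprox.errorsBounded M B C r) (RankApprox.hsNorm (M - S)) := by
  open RankApprox in
  have hYhs := isHilbertSchmidt_of_mem_boundedRankLE hY.1
  have hYC := comp_projKerPerp_of_mem_classY hM hY
  obtain ⟨Z, hZ, hBZ, hZr, hZB⟩ :=
    exists_mpInv_comp B hY.1 (range_le_range_of_mem_classY hM hY)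
  have hX : hatX B C Y = pcomp (everywhere Z) (mpInv C) := pcomp_pcomp_everywhere hZ _
  have hdom : (hatX B C Y).domain = (mpInv C).domain := by rw [hX, domain_pcomp_everywhere]
  have hXC : ∀ x, ∃ h : C x ∈ (hatX B C Y).domain, B (hatX B C Y ⟨C x, h⟩) = Y x := by
    intro x
    rw [hX]
    have h1 := mem_domain_mpInv C x
    have h2 : C x ∈ (pcomp (everywhere Z) (mpInv C)).domain := by rwa [domain_pcomp_everywhere]
    refine ⟨h2, ?_⟩
    rw [pcomp_everywhere_apply Z _ h2 h1, mpInv_apply_apply]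
    change (B ∘L Z) _ = _
    rw [hBZ]
    exact DFunLike.congr_fun hYC x
  have hS : pcomp (everywhere B) (pcomp (hatX B C Y) (everywhere C)) = everywhere Y := by
    refine eq_everywhere fun x => ?_
    obtain ⟨h1, h2⟩ := hXC x
    have hx : x ∈ (pcomp (hatX B C Y) (everywhere C)).domain :=
      mem_domain_pcomp.2 ⟨mem_domain_everywhere C x, h1⟩
    have hx' : x ∈ (pcomp (everywhere B) (pcomp (hatX B C Y) (everywhere C))).domain := by
      rwa [domain_pcomp_everywhere]
    exact ⟨hx', h2⟩
  have hrank : LinearMap.rank (hatX B C Y).toFun ≤ r := by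
    have h1 : LinearMap.range (hatX B C Y).toFun ≤ Z.range := by
      rw [hX]
      rintro _ ⟨⟨x, hx⟩, rfl⟩
      exact ⟨_, rfl⟩
    exact (Submodule.rank_mono h1).trans hZr
  have hclass : hatX B C Y ∈ classX B C r := ⟨hdom.ge, hrank, Y, hS, hYhs⟩
  -- The operator `B X̂ C` is `Y` itself.
  refine ⟨Y, hS, hYhs, hclass, hdom, fun V _ hmono hVC hV => ?_, ⟨?_, ?_⟩, ?_, ?_⟩
  · obtain ⟨X, h1, h2, h3, h4, h5, h6⟩ := exists_bounded_approx hZr hZ hBZ hZB hYhs hYC V hmono hVC hV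
    refine ⟨X, h1, h2, h3, h4, ?_, h6⟩
    -- Comparing with `R = Y` makes the limit of the norms zero.
    have h7 := h5 Y hYhs
    have h8 : hsNorm (Y - Y) = 0 := by simp [hsNorm]
    rw [h8] at h7
    refine h7.congr fun n => ?_
    simp only [hsNorm, sub_apply, norm_sub_rev]
  · exact ⟨_, hclass, Y, hS, rfl⟩
  · rintro _ ⟨X, ⟨_, hXr, _⟩, S, hXS, rfl⟩
    have hap := exists_apply_of_pcomp_eq_everywhere hXS
    refine hsNorm_sub_le_of_mem_classY hM hY (mem_boundedRankLE_of_range_le_map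
      (W := LinearMap.range X.toFun) hXr (B : H₃ →ₗ[𝕜] H₄) ?_) (fun x hx => ?_) ?_
    · rintro _ ⟨x, rfl⟩
      obtain ⟨h1, h2⟩ := hap x
      exact ⟨_, ⟨⟨C x, h1⟩, rfl⟩, h2.symm⟩
    · obtain ⟨h1, h2⟩ := hap x
      have h3 : (⟨C x, h1⟩ : X.domain) = 0 := Subtype.ext hx
      rw [h2, h3, LinearPMap.map_zero, map_zero]
    · rintro _ ⟨x, rfl⟩
      obtain ⟨h1, h2⟩ := hap x
      exact ⟨_, h2.symm⟩
  · rintro _ ⟨X, hXr, rfl⟩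
    refine hsNorm_sub_le_of_mem_classY hM hY
      (comp_left_mem_boundedRankLE (comp_right_mem_boundedRankLE hXr C) B) (fun x hx => ?_) ?_
    · simp [hx]
    · rintro _ ⟨x, rfl⟩
      exact ⟨X (C x), rfl⟩
  -- The infimum need not be attained by a bounded operator. Separability of `H₂` supplies an
  -- exhausting sequence, and the errors of the resulting `X̂ₙ` tend to `‖M - Y‖` (the case `R =
  -- M`).
  · intro e he
    obtain ⟨V, _, hmono, hVC, hV⟩ :=
      exists_monotone_finiteDimensional C.range.topologicalClosure
    have hV' : closure (⋃ n, (V n : Set H₂)) = closure (Set.range C) := by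
      rw [hV, Submodule.topologicalClosure_coe, closure_closure]
      rfl
    obtain ⟨X, -, h2, -, -, h5, -⟩ := exists_bounded_approx hZr hZ hBZ hZB hYhs hYC V hmono hVC hV'
    exact ge_of_tendsto (h5 M hM) (.of_forall fun n => he ⟨X n, h2 n, rfl⟩)
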